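/- Let $q$ be an odd prime power and let $m \ge 6$ be an integer. For $0 \le i \le m$ let $\sigma_m^i \in \mathbb{F}_q[x_1,\dots,x_m]$ denote the $i$-th elementary symmetric polynomial in $x_1,\dots,x_m$ (with $\sigma_m^0 = 1$), and let $$v_m = \prod_{1 \le i < j \le m} (x_i - x_j)$$ be the Vandermonde polynomial. Let $s_1 = \sum_{i=0}^m a_i \sigma_m^i$ and $s_2 = \sum_{i=0}^m b_i \sigma_m^i$ with $a_i, b_i \in \mathbb{F}_q$. If $s_1$ and $s_2$ are linearly independent over $\mathbb{F}_q$, then the polynomial $$F = s_1 v_m + s_2 \in \mathbb{F}_q[x_1,\dots,x_m]$$ is absolutely irreducible, i.e. irreducible in $\overline{\mathbb{F}}_q[x_1,\dots,x_m]$, where $\overline{\mathbb{F}}_q$ is the algebraic closure of $\mathbb{F}_q$. -/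

import Mathlib

/-- The Vandermonde polynomial `∏_{i < j} (x_i - x_j)` in the `m` variables indexed by `Fin m`. -/
noncomputable def vandermondePolynomial (K : Type*) [CommRing K] (m : ℕ) :
    MvPolynomial (Fin m) K :=
  ∏ i : Fin m, ∏ j ∈ Finset.Ioi i, (MvPolynomial.X i - MvPolynomial.X j)

/-- The space of `K`-linear combinations `a_0 σ_0 + a_1 σ_1 + ⋯ + a_m σ_m` of the elementary
symmetric polynomials in `m` variables, where `σ_0 = 1`. -/
noncomputable def elementarySymmetricSpace (K : Type*) [CommRing K] (m : ℕ) :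
    Submodule K (MvPolynomial (Fin m) K) :=
  Submodule.span K (Set.range fun i : Fin (m + 1) => MvPolynomial.esymm (Fin m) K (i : ℕ))

/-- A polynomial over a field `K` is absolutely irreducible if it is irreducible as a polynomial
over the algebraic closure of `K`. -/
def IsAbsolutelyIrreducible {K : Type*} [Field K] {σ : Type*} (F : MvPolynomial σ K) : Prop :=
  Irreducible (MvPolynomial.map (algebraMap K (AlgebraicClosure K)) F)

/-!
Write `v` for the Vandermonde polynomial and `F = s₁ * v + s₂`, over any field in which `2 ≠ 0`
and for `5 ≤ m`. All that is used of `s₁` and `s₂` is that they are symmetric, of degree at most one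
in each variable, nonzero and not proportional. Even permutations of the variables fix `F`, and odd
ones turn it into `-s₁ * v + s₂`.

The degree of `s₂` is at most `m`, which is less than that of `v`, so the leading form of `F` is the
leading form of `s₁` times `v`. Since a nonzero symmetric polynomial of degree at most one in each
variable is not divisible by any `X i - X j` (`not_X_sub_X_dvd_of_isSymmetric`), each `X i - X j`
divides the leading form of `F` exactly once. Hence every pair `i ≠ j` has, up to units, exactly one
irreducible factor of `F` whose leading form is divisible by `X i - X j` (`IsFactorAt`), and the
alternating group permutes these factors as it permutes the pairs. This action on pairs is primitive
(`SimpleGraph.eq_top_of_forall_even`), so the factors either all coincide or are pairwise coprime.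

If they all coincide with one `f`, then `v` divides the leading form of `f`, so the cofactor `h` of
`f` has degree at most one in each variable. The alternating group preserves `h` up to constants,
and therefore fixes it, being perfect; by `isSymmetric_of_forall_sign_eq_one`, `h` is symmetric.
Then `h` divides both `-s₁ * v + s₂` and `s₁ * v + s₂`, hence `s₂` and `s₁`, and a degree count
in each variable makes `h` constant, as `s₁` and `s₂` are not proportional
(`irreducible_of_forall_isFactorAt`).

If they are pairwise coprime, their product divides `F`. With `N = m (m - 1) / 2` factors and
`deg F ≤ N + m < 2 N`, one of them has degree one, so it is `c * (X i - X j) + d`. The even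
permutation `(i j)(k l)` preserves it up to a unit, which forces `d = 0`; then `X i - X j` divides
`F` and so `s₂`, a contradiction (`IsFactorAt.two_le_totalDegree`).
-/

open MvPolynomial

namespace MvPolynomial

variable {σ R : Type*}

/-! ### Divisibility by the difference of two variables -/

/-- Divisibility by `X i - X j` means vanishing under the substitution of `X j` for `X i`. -/
theorem X_sub_X_dvd_iff [DecidableEq σ] [CommRing R] (i j : σ) (f : MvPolynomial σ R) :
    X i - X j ∣ f ↔ rename (Function.update id i j) f = 0 := by
  constructor
  · rintro ⟨g, rfl⟩
    rcases eq_or_ne j i with rfl | h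
    · simp
    · simp [Function.update_of_ne h]
  · intro h
    have key : ∀ g : MvPolynomial σ R, X i - X j ∣ g - rename (Function.update id i j) g := by
      intro g
      induction g using MvPolynomial.induction_on with
      | C a => simp
      | add p q hp hq =>
        rw [map_add, add_sub_add_comm]
        exact dvd_add hp hq
      | mul_X p k hp =>
        have hk : X i - X j ∣ (X k : MvPolynomial σ R) - X (Function.update id i j k) := by
          rcases eq_or_ne k i with rfl | hki
          · simp
          · simp [Function.update_of_ne hki]
        rw [map_mul, rename_X]
        have : p * X k - rename (Function.update id i j) p * X (Function.update id i j k) =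
            (p - rename (Function.update id i j) p) * X k +
            rename (Function.update id i j) p * (X k - X (Function.update id i j k)) := by ring
        rw [this]
        exact dvd_add (hp.mul_right _) (hk.mul_left _)
    simpa [h] using key f

theorem X_sub_X_ne_zero [CommRing R] [Nontrivial R] {i j : σ} (h : i ≠ j) :
    (X i - X j : MvPolynomial σ R) ≠ 0 :=
  sub_ne_zero.mpr fun e => h (X_injective e)

theorem prime_X_sub_X [DecidableEq σ] [CommRing R] [IsDomain R] {i j : σ} (h : i ≠ j) :
    Prime (X i - X j : MvPolynomial σ R) := by
  refine ⟨X_sub_X_ne_zero h, fun hu => ?_, fun a b hab => ?_⟩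
  · have := (X_sub_X_dvd_iff i j (1 : MvPolynomial σ R)).1 hu.dvd
    simp at this
  · simpa [X_sub_X_dvd_iff] using hab

section Swap

variable [DecidableEq σ] [CommRing R]

/-- Swapping two variables is invisible after identifying them. -/
theorem rename_update_rename_swap (i j : σ) (f : MvPolynomial σ R) :
    rename (Function.update id i j) (rename (Equiv.swap i j) f) =
      rename (Function.update id i j) f := by
  rw [rename_rename]
  congr 2
  funext k
  rcases eq_or_ne k i with rfl | hi
  · rcases eq_or_ne j k with rfl | hj <;> simp [*]
  · rcases eq_or_ne k j with rfl | hj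
    · simp [Function.update_of_ne hi]
    · simp [Equiv.swap_apply_of_ne_of_ne hi hj]

variable [IsDomain R]

theorem X_sub_X_dvd_of_rename_swap_eq_neg (h2 : (2 : R) ≠ 0) {i j : σ} {f : MvPolynomial σ R}
    (hf : rename (Equiv.swap i j) f = -f) : X i - X j ∣ f := by
  have h := rename_update_rename_swap i j f
  rw [hf, map_neg] at h
  rw [X_sub_X_dvd_iff]
  have h2' : (C 2 : MvPolynomial σ R) ≠ 0 := by simpa using h2
  refine (mul_eq_zero.1 ?_).resolve_left h2'
  rw [show (C 2 : MvPolynomial σ R) = 2 from map_ofNat C 2]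
  linear_combination -h

theorem X_sub_X_sq_dvd_of_rename_swap_eq (h2 : (2 : R) ≠ 0) {i j : σ} (hij : i ≠ j)
    {f : MvPolynomial σ R} (hf : rename (Equiv.swap i j) f = f) (hd : X i - X j ∣ f) :
    (X i - X j) ^ 2 ∣ f := by
  obtain ⟨t, rfl⟩ := hd
  rw [pow_two]
  refine mul_dvd_mul_left _ (X_sub_X_dvd_of_rename_swap_eq_neg h2 ?_)
  apply mul_left_cancel₀ (X_sub_X_ne_zero (R := R) hij)
  simp only [map_mul, map_sub, rename_X, Equiv.swap_apply_left, Equiv.swap_apply_right] at hf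
  linear_combination -hf

theorem degreeOf_X_sub_X {i j : σ} (hij : i ≠ j) :
    1 ≤ degreeOf i (X i - X j : MvPolynomial σ R) := by
  have : Finsupp.single i 1 ∈ (X i - X j : MvPolynomial σ R).support := by
    have hne : Finsupp.single j 1 ≠ Finsupp.single i 1 := fun h =>
      hij (Finsupp.single_left_injective one_ne_zero h).symm
    simp [mem_support_iff, coeff_X, hne]
  simpa using monomial_le_degreeOf i this

/-- A symmetric polynomial divisible by `X i - X j` is divisible by its square, which has degree
two in `X i`. -/
theorem not_X_sub_X_dvd_of_isSymmetric (h2 : (2 : R) ≠ 0) {i j : σ} (hij : i ≠ j)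
    {s : MvPolynomial σ R} (hs : s.IsSymmetric) (hdeg : ∀ k, degreeOf k s ≤ 1) (h0 : s ≠ 0) :
    ¬ X i - X j ∣ s := by
  intro hd
  obtain ⟨t, rfl⟩ := X_sub_X_sq_dvd_of_rename_swap_eq h2 hij (hs _) hd
  have h := hdeg i
  rw [degreeOf_mul_eq (left_ne_zero_of_mul h0) (right_ne_zero_of_mul h0),
    degreeOf_pow_eq _ _ _ (X_sub_X_ne_zero hij)] at h
  have := degreeOf_X_sub_X (R := R) hij
  omega

end Swap

/-! ### Leading forms -/

section LeadingForm

variable [CommRing R]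

/-- The leading form of a polynomial: its homogeneous component of top total degree. -/
noncomputable def leadingForm (f : MvPolynomial σ R) : MvPolynomial σ R :=
  homogeneousComponent f.totalDegree f

theorem leadingForm_ne_zero {f : MvPolynomial σ R} (hf : f ≠ 0) : leadingForm f ≠ 0 := by
  obtain ⟨d, hd, hdeg⟩ := Finset.exists_mem_eq_sup f.support (support_nonempty.2 hf)
    fun s => s.sum fun _ e => e
  intro h
  have h' := congrArg (coeff d) h
  rw [leadingForm, coeff_homogeneousComponent, if_pos] at h'
  · exact mem_support_iff.1 hd h'
  · rw [totalDegree, hdeg]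
    rfl

theorem isHomogeneous_leadingForm (f : MvPolynomial σ R) :
    (leadingForm f).IsHomogeneous f.totalDegree :=
  homogeneousComponent_isHomogeneous _ _

theorem leadingForm_of_isHomogeneous {f : MvPolynomial σ R} {n : ℕ} (hf : f.IsHomogeneous n) :
    leadingForm f = f := by
  rcases eq_or_ne f 0 with rfl | h0
  · simp [leadingForm]
  · rw [leadingForm, hf.totalDegree h0]
    exact homogeneousComponent_eq_self hf

/-- In degrees bounding the total degrees, taking homogeneous components is multiplicative. -/
theorem homogeneousComponent_add_mul {f g : MvPolynomial σ R} {a b : ℕ}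
    (hf : f.totalDegree ≤ a) (hg : g.totalDegree ≤ b) :
    homogeneousComponent (a + b) (f * g) = homogeneousComponent a f * homogeneousComponent b g := by
  -- The remainder is kept as zero or of degree below `n`, since for `n = 0` it can only be zero.
  have key : ∀ (p : MvPolynomial σ R) (n : ℕ), p.totalDegree ≤ n →
      ∃ r, p = homogeneousComponent n p + r ∧ (r = 0 ∨ r.totalDegree < n) := by
    intro p n hp
    refine ⟨p - homogeneousComponent n p, by ring, ?_⟩
    by_cases hr : p - homogeneousComponent n p = 0
    · exact Or.inl hr
    right
    obtain ⟨d, hd, hdeg⟩ := Finset.exists_mem_eq_sup _ (support_nonempty.2 hr)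
      fun s => s.sum fun _ e => e
    rw [totalDegree, hdeg]
    rw [mem_support_iff, coeff_sub, coeff_homogeneousComponent] at hd
    split_ifs at hd with hdn
    · simp at hd
    · have : d ∈ p.support := by simpa using hd
      have h1 := (le_totalDegree this).trans hp
      exact lt_of_le_of_ne h1 hdn
  obtain ⟨r, hr, hr'⟩ := key f a hf
  obtain ⟨t, ht, ht'⟩ := key g b hg
  have hz : ∀ p q : MvPolynomial σ R, p.totalDegree + q.totalDegree < a + b →
      homogeneousComponent (a + b) (p * q) = 0 := fun p q h =>
    homogeneousComponent_eq_zero _ _ ((totalDegree_mul p q).trans_lt h)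
  have h1 : homogeneousComponent (a + b) (r * g) = 0 := by
    rcases hr' with rfl | h
    · simp
    · exact hz _ _ (by omega)
  have h2 : homogeneousComponent (a + b) (homogeneousComponent a f * t) = 0 := by
    rcases ht' with rfl | h
    · simp
    · exact hz _ _ (by have := (homogeneousComponent_isHomogeneous a f).totalDegree_le; omega)
  have e : f * g = homogeneousComponent a f * homogeneousComponent b g +
      homogeneousComponent a f * t + r * g := by
    conv_lhs => rw [hr, add_mul]
    conv_lhs => enter [1, 2]; rw [ht]
    ring
  rw [e, map_add, map_add, h1, h2, add_zero, add_zero]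
  exact homogeneousComponent_eq_self
    ((homogeneousComponent_isHomogeneous a f).mul (homogeneousComponent_isHomogeneous b g))

theorem leadingForm_mul [IsDomain R] (f g : MvPolynomial σ R) :
    leadingForm (f * g) = leadingForm f * leadingForm g := by
  rcases eq_or_ne f 0 with rfl | hf
  · simp [leadingForm]
  rcases eq_or_ne g 0 with rfl | hg
  · simp [leadingForm]
  rw [leadingForm, totalDegree_mul_of_isDomain hf hg]
  exact homogeneousComponent_add_mul le_rfl le_rfl

theorem leadingForm_dvd [IsDomain R] {f g : MvPolynomial σ R} (h : f ∣ g) :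
    leadingForm f ∣ leadingForm g := by
  obtain ⟨k, rfl⟩ := h
  exact leadingForm_mul f k ▸ dvd_mul_right _ _

theorem leadingForm_add_of_totalDegree_lt {f g : MvPolynomial σ R}
    (h : g.totalDegree < f.totalDegree) : leadingForm (f + g) = leadingForm f := by
  rw [leadingForm, totalDegree_add_eq_left_of_totalDegree_lt h, map_add,
    homogeneousComponent_eq_zero _ _ h, add_zero, leadingForm]

theorem leadingForm_rename (g : Equiv.Perm σ) (f : MvPolynomial σ R) :
    leadingForm (rename g f) = rename g (leadingForm f) := by
  have h : (rename g f).totalDegree = f.totalDegree := totalDegree_renameEquiv g f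
  rw [leadingForm, h, leadingForm, rename_homogeneousComponent]

theorem degreeOf_leadingForm_le (i : σ) (f : MvPolynomial σ R) :
    degreeOf i (leadingForm f) ≤ degreeOf i f := by
  rw [degreeOf_le_iff]
  intro d hd
  rw [leadingForm, support_homogeneousComponent, Finset.mem_filter] at hd
  exact monomial_le_degreeOf i hd.1

/-- A prime dividing the leading form of `F` divides the leading form of an irreducible factor
of `F`. -/
theorem exists_irreducible_dvd_leadingForm {K : Type*} [Field K] {F p : MvPolynomial σ K}
    (hF : F ≠ 0) (hp : Prime p) (h : p ∣ leadingForm F) :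
    ∃ f, Irreducible f ∧ f ∣ F ∧ p ∣ leadingForm f := by
  induction F using WfDvdMonoid.induction_on_irreducible with
  | zero => exact absurd rfl hF
  | unit u hu =>
    obtain ⟨c, -, rfl⟩ := isUnit_iff_eq_C_of_isReduced.1 hu
    rw [leadingForm_of_isHomogeneous (isHomogeneous_C σ c)] at h
    exact absurd (isUnit_of_dvd_unit h hu) hp.not_isUnit
  | mul a i ha hi ih =>
    rw [leadingForm_mul] at h
    rcases hp.dvd_or_dvd h with h | h
    · exact ⟨i, hi, dvd_mul_right _ _, h⟩
    · obtain ⟨f, h1, h2, h3⟩ := ih ha h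
      exact ⟨f, h1, h2.mul_left _, h3⟩

end LeadingForm

end MvPolynomial

/-! ### The Vandermonde polynomial -/

section Vandermonde

variable {R : Type*} [CommRing R] {m : ℕ}

/-- The pairs `(i, j)` with `i < j`, indexing the factors of the Vandermonde polynomial. -/
def orderedPairs (m : ℕ) : Finset (Fin m × Fin m) :=
  Finset.univ.filter fun p => p.1 < p.2

theorem mem_orderedPairs {p : Fin m × Fin m} : p ∈ orderedPairs m ↔ p.1 < p.2 := by
  simp [orderedPairs]

theorem card_orderedPairs_mul_two (m : ℕ) : (orderedPairs m).card * 2 = m * (m - 1) := by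
  have h : (orderedPairs m).card = ∑ i ∈ Finset.range m, i := by
    rw [orderedPairs, Finset.card_filter, ← Finset.univ_product_univ, Finset.sum_product_right,
      ← Fin.sum_univ_eq_sum_range fun i => i]
    refine Finset.sum_congr rfl fun i _ => ?_
    rw [← Finset.card_filter, show Finset.univ.filter (fun x => x < i) = Finset.Iio i by ext; simp, Fin.card_Iio]
  rw [h, Finset.sum_range_id_mul_two]

theorem lt_card_orderedPairs (hm : 5 ≤ m) : m < (orderedPairs m).card := by
  have h := card_orderedPairs_mul_two m
  obtain ⟨k, rfl⟩ := Nat.exists_eq_add_of_le hm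
  have : 5 + k - 1 = 4 + k := by omega
  rw [this] at h
  nlinarith

theorem vandermondePolynomial_eq_prod :
    vandermondePolynomial R m = ∏ p ∈ orderedPairs m, (X p.1 - X p.2) := by
  rw [vandermondePolynomial, orderedPairs, Finset.prod_filter, ← Finset.univ_product_univ,
    Finset.prod_product]
  refine Finset.prod_congr rfl fun i _ => ?_
  rw [← Finset.prod_filter]
  congr 1
  ext j
  simp

theorem map_vandermondePolynomial {S : Type*} [CommRing S] (φ : R →+* S) :
    map φ (vandermondePolynomial R m) = vandermondePolynomial S m := by
  simp [vandermondePolynomial, map_prod]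

theorem rename_vandermondePolynomial (g : Equiv.Perm (Fin m)) :
    rename g (vandermondePolynomial R m) =
      ((Equiv.Perm.sign g : ℤ) : MvPolynomial (Fin m) R) * vandermondePolynomial R m := by
  -- With nodes `-X i` the Vandermonde determinant has the factors `X i - X j` for `i < j`.
  have h : vandermondePolynomial R m =
      (Matrix.vandermonde fun i : Fin m => -(X i : MvPolynomial (Fin m) R)).det := by
    rw [Matrix.det_vandermonde, vandermondePolynomial]
    refine Finset.prod_congr rfl fun i _ => Finset.prod_congr rfl fun j _ => by ring
  have h' : rename g (vandermondePolynomial R m) =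
      ((Matrix.vandermonde fun i : Fin m => -(X i : MvPolynomial (Fin m) R)).submatrix g id).det := by
    rw [h, AlgHom.map_det]
    congr 1
    ext i j
    simp [Matrix.vandermonde]
  rw [h', Matrix.det_permute, ← h]

theorem isHomogeneous_vandermondePolynomial :
    (vandermondePolynomial R m).IsHomogeneous (orderedPairs m).card := by
  rw [vandermondePolynomial_eq_prod, Finset.card_eq_sum_ones]
  exact IsHomogeneous.prod _ _ _ fun p _ => (isHomogeneous_X R p.1).sub (isHomogeneous_X R p.2)

theorem vandermondePolynomial_ne_zero [IsDomain R] : vandermondePolynomial R m ≠ 0 := by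
  rw [vandermondePolynomial_eq_prod, Finset.prod_ne_zero_iff]
  exact fun p hp => X_sub_X_ne_zero (mem_orderedPairs.1 hp).ne

theorem X_sub_X_dvd_vandermondePolynomial {i j : Fin m} (hij : i ≠ j) :
    X i - X j ∣ vandermondePolynomial R m := by
  have key : ∀ p ∈ orderedPairs m,
      (X p.1 - X p.2 : MvPolynomial (Fin m) R) ∣ vandermondePolynomial R m := fun p hp =>
    vandermondePolynomial_eq_prod (R := R) ▸
      Finset.dvd_prod_of_mem (fun p : Fin m × Fin m => (X p.1 - X p.2 : MvPolynomial _ R)) hp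
  rcases lt_or_gt_of_ne hij with h | h
  · exact key (i, j) (mem_orderedPairs.2 h)
  · rw [← neg_sub, neg_dvd]
    exact key (j, i) (mem_orderedPairs.2 h)

/-- The linear factors of the Vandermonde polynomial are pairwise distinct, so a multiple `t * v`
is divisible by the square of one of them only if `t` is divisible by that factor. -/
theorem not_X_sub_X_sq_dvd_mul_vandermondePolynomial [IsDomain R] {i j : Fin m} (hij : i ≠ j)
    {t : MvPolynomial (Fin m) R} (ht : ¬ X i - X j ∣ t) :
    ¬ (X i - X j) ^ 2 ∣ t * vandermondePolynomial R m := by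
  wlog h : i < j generalizing i j
  · rw [← neg_sub, neg_sq]
    refine this hij.symm ?_ (lt_of_le_of_ne (not_lt.1 h) hij.symm)
    rwa [← neg_sub, neg_dvd]
  have hmem : (i, j) ∈ orderedPairs m := mem_orderedPairs.2 h
  rw [vandermondePolynomial_eq_prod, ← Finset.mul_prod_erase _ _ hmem, pow_two, mul_left_comm]
  intro hd
  have hp := prime_X_sub_X (R := R) hij
  rcases hp.dvd_or_dvd ((mul_dvd_mul_iff_left hp.ne_zero).1 hd) with hd | hd
  · exact ht hd
  obtain ⟨⟨k, l⟩, hkl, hd⟩ := (hp.dvd_finsetProd_iff _).1 hd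
  rw [Finset.mem_erase, mem_orderedPairs] at hkl
  obtain ⟨hne, hlt⟩ := hkl
  rw [X_sub_X_dvd_iff, map_sub, rename_X, rename_X, sub_eq_zero] at hd
  have := X_injective hd
  simp only [Function.update_apply, id] at this
  split_ifs at this with h1 h2 h2
  · exact hlt.ne (h1.trans h2.symm)
  · exact hne (by rw [h1, this])
  · simp only at hlt h1 h2 this
    subst h2
    subst this
    exact lt_asymm h hlt
  · exact hlt.ne this

end Vandermonde

/-! ### Multi-affine polynomials and the alternating group -/

section Multiaffine

variable {σ : Type*} [Fintype σ] {R : Type*} [CommRing R]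

theorem MvPolynomial.totalDegree_le_card_of_degreeOf_le_one {f : MvPolynomial σ R}
    (h : ∀ i, degreeOf i f ≤ 1) : f.totalDegree ≤ Fintype.card σ := by
  refine Finset.sup_le fun d hd => ?_
  rw [Finsupp.sum_fintype _ _ fun _ => rfl]
  calc ∑ i, d i ≤ ∑ _i : σ, 1 :=
        Finset.sum_le_sum fun i _ => (monomial_le_degreeOf i hd).trans (h i)
    _ = Fintype.card σ := by simp

/-- A multi-affine polynomial in at least three variables that is invariant under the alternating
group is symmetric: every exponent in `{0, 1}` takes some value twice, and so is fixed by a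
transposition, which makes up for the sign of any permutation. -/
theorem MvPolynomial.isSymmetric_of_forall_sign_eq_one [DecidableEq σ] (hσ : 3 ≤ Fintype.card σ)
    {f : MvPolynomial σ R} (hdeg : ∀ i, degreeOf i f ≤ 1)
    (hf : ∀ g : Equiv.Perm σ, Equiv.Perm.sign g = 1 → rename g f = f) : f.IsSymmetric := by
  intro g
  rcases Int.units_eq_one_or (Equiv.Perm.sign g) with hg | hg
  · exact hf g hg
  ext d
  obtain ⟨d, rfl⟩ := (Finsupp.mapDomain_surjective g.surjective) d
  rw [coeff_rename_mapDomain _ g.injective]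
  by_cases hd : ∃ k, 2 ≤ d k
  · obtain ⟨k, hk⟩ := hd
    have hz : ∀ (e : σ →₀ ℕ) (l : σ), 2 ≤ e l → coeff e f = 0 := fun e l hl => by
      by_contra h
      have h1 := monomial_le_degreeOf l (mem_support_iff.2 h)
      have h2 := hdeg l
      omega
    rw [hz d k hk, hz _ (g k) (by rwa [Finsupp.mapDomain_apply g.injective])]
  · push Not at hd
    obtain ⟨a, b, hab, h⟩ := Fintype.exists_ne_map_eq_of_card_lt
      (fun k => (⟨d k, hd k⟩ : Fin 2)) (by simpa using Nat.lt_of_succ_le hσ)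
    have h : d a = d b := congrArg Fin.val h
    have hfix : d.mapDomain (Equiv.swap a b) = d := by
      ext k
      obtain ⟨k, rfl⟩ := (Equiv.swap a b).surjective k
      rw [Finsupp.mapDomain_apply (Equiv.swap a b).injective]
      rcases eq_or_ne k a with rfl | ha
      · simp [h]
      rcases eq_or_ne k b with rfl | hb
      · simp [h]
      rw [Equiv.swap_apply_of_ne_of_ne ha hb]
    have h1 := coeff_rename_mapDomain (g * Equiv.swap a b) (g * Equiv.swap a b).injective f d
    rw [hf _ (by rw [Equiv.Perm.sign_mul, hg, Equiv.Perm.sign_swap hab]; rfl),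
      Equiv.Perm.coe_mul, Finsupp.mapDomain_comp, hfix] at h1
    exact h1.symm

end Multiaffine

/-- The alternating group on at least five letters is perfect, so a polynomial whose line it
preserves is invariant. -/
theorem MvPolynomial.rename_eq_of_forall_associated {σ : Type*} [Fintype σ] [DecidableEq σ]
    {K : Type*} [Field K] (hσ : 5 ≤ Fintype.card σ) {f : MvPolynomial σ K} (h0 : f ≠ 0)
    (hf : ∀ g : Equiv.Perm σ, Equiv.Perm.sign g = 1 → Associated f (rename g f))
    {g : Equiv.Perm σ} (hg : Equiv.Perm.sign g = 1) : rename g f = f := by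
  have hc : ∀ g : alternatingGroup σ, ∃ c : K, rename (g : Equiv.Perm σ) f = C c * f := by
    intro g
    obtain ⟨u, hu⟩ := hf g (Equiv.Perm.mem_alternatingGroup.1 g.2)
    obtain ⟨c, -, hc⟩ := isUnit_iff_eq_C_of_isReduced.1 u.isUnit
    exact ⟨c, by rw [← hu, hc, mul_comm]⟩
  choose χ hχ using hc
  have hinj : ∀ a b : K, C a * f = C b * f → a = b := fun a b h =>
    C_injective σ K (mul_right_cancel₀ h0 h)
  let ψ : alternatingGroup σ →* K :=
    { toFun := χ
      map_one' := hinj _ _ (by rw [← hχ]; simp)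
      map_mul' := fun a b => hinj _ _ (by
        rw [← hχ, Subgroup.coe_mul, Equiv.Perm.coe_mul, ← rename_rename, hχ b, map_mul, rename_C,
          hχ a, C_mul]
        ring) }
  have hker := Abelianization.commutator_subset_ker ψ.toHomUnits
  rw [commutator_alternatingGroup_eq_top (by rwa [Nat.card_eq_fintype_card])] at hker
  let g' : alternatingGroup σ := ⟨g, Equiv.Perm.mem_alternatingGroup.2 hg⟩
  have h1 : ψ.toHomUnits g' = 1 := hker (Subgroup.mem_top g')
  have h2 : χ g' = 1 := by simpa [ψ] using congrArg Units.val h1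
  simpa [h2] using hχ g'

/-! ### Graphs with many even automorphisms -/

theorem Equiv.Perm.exists_sign_eq_one_three_cycle {α : Type*} [Fintype α] [DecidableEq α]
    {x y z : α} (hxy : x ≠ y) (hyz : y ≠ z) (hxz : x ≠ z) :
    ∃ g : Equiv.Perm α, Equiv.Perm.sign g = 1 ∧ g x = y ∧ g y = z ∧ g z = x ∧
      ∀ w, w ≠ x → w ≠ y → w ≠ z → g w = w := by
  refine ⟨Equiv.swap x y * Equiv.swap y z, ?_, ?_, ?_, ?_, fun w h1 h2 h3 => ?_⟩
  · rw [Equiv.Perm.sign_mul, Equiv.Perm.sign_swap hxy, Equiv.Perm.sign_swap hyz]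
    rfl
  · simp [Equiv.swap_apply_of_ne_of_ne hxy hxz]
  · simp [Equiv.swap_apply_of_ne_of_ne hxz.symm hyz.symm]
  · simp
  · simp [Equiv.swap_apply_of_ne_of_ne, h1, h2, h3]

theorem exists_ne_four {α : Type*} [Fintype α] [DecidableEq α] (hα : 5 ≤ Fintype.card α)
    (a b c d : α) : ∃ e, e ≠ a ∧ e ≠ b ∧ e ≠ c ∧ e ≠ d := by
  have : ({a, b, c, d} : Finset α).card < (Finset.univ : Finset α).card :=
    (Finset.card_le_four).trans_lt hα
  obtain ⟨e, -, he⟩ := Finset.exists_mem_notMem_of_card_lt_card this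
  exact ⟨e, by simpa using he⟩

/-- If every even permutation that maps some edge of a graph on at least five vertices to an edge
is an automorphism, then the graph has at most one edge or is complete. This expresses that the
action of the alternating group on unordered pairs is primitive. -/
theorem SimpleGraph.eq_top_of_forall_even {α : Type*} [Fintype α] [DecidableEq α]
    (hα : 5 ≤ Fintype.card α) {G : SimpleGraph α}
    (hG : ∀ g : Equiv.Perm α, Equiv.Perm.sign g = 1 → ∀ a b, G.Adj a b → G.Adj (g a) (g b) →
      ∀ x y, G.Adj x y → G.Adj (g x) (g y))
    {a b c d : α} (hab : G.Adj a b) (hcd : G.Adj c d) (hne : s(a, b) ≠ s(c, d)) : G = ⊤ := by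
  -- Two edges with a common vertex generate all others under suitable three-cycles.
  have key : ∀ a b c : α, G.Adj a b → G.Adj a c → b ≠ c → G = ⊤ := by
    intro a b c hab hac hbc
    have hstar : ∀ d, d ≠ a → G.Adj a d := by
      intro d hda
      rcases eq_or_ne d b with rfl | hdb
      · exact hab
      rcases eq_or_ne d c with rfl | hdc
      · exact hac
      obtain ⟨e, hea, heb, hec, hed⟩ := exists_ne_four hα a b c d
      obtain ⟨g, hg, h1, -, -, h4⟩ :=
        Equiv.Perm.exists_sign_eq_one_three_cycle hdc.symm hed.symm hec.symm
      have ha : g a = a := h4 a hac.ne hda.symm hea.symm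
      have hb : g b = b := h4 b hbc hdb.symm heb.symm
      have := hG g hg a b hab (by rwa [ha, hb]) a c hac
      rwa [ha, h1] at this
    rw [eq_top_iff]
    intro x y hxy
    rw [SimpleGraph.top_adj] at hxy
    rcases eq_or_ne x a with rfl | hxa
    · exact hstar y hxy.symm
    rcases eq_or_ne y a with rfl | hya
    · exact (hstar x hxa).symm
    obtain ⟨g, hg, h1, h2, h3, -⟩ :=
      Equiv.Perm.exists_sign_eq_one_three_cycle hxa.symm hxy hya.symm
    have := hG g hg a y (hstar y hya) (by rw [h1, h3]; exact (hstar x hxa).symm) a x (hstar x hxa)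
    rwa [h1, h2] at this
  by_cases hac : a = c
  · subst hac
    exact key a b d hab hcd fun h => hne (by rw [h])
  by_cases had : a = d
  · subst had
    exact key a b c hab hcd.symm fun h => hne (by rw [h, Sym2.eq_swap])
  by_cases hbc : b = c
  · subst hbc
    exact key b a d hab.symm hcd had
  by_cases hbd : b = d
  · subst hbd
    exact key b a c hab.symm hcd.symm hac
  obtain ⟨e, hea, heb, hec, hed⟩ := exists_ne_four hα a b c d
  obtain ⟨g, hg, h1, h2, -, h4⟩ :=
    Equiv.Perm.exists_sign_eq_one_three_cycle hcd.ne hed.symm hec.symm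
  have ha : g a = a := h4 a hac had hea.symm
  have hb : g b = b := h4 b hbc hbd heb.symm
  have := hG g hg a b hab (by rwa [ha, hb]) c d hcd
  rw [h1, h2] at this
  exact key d c e hcd.symm this hec.symm

/-! ### Irreducible factors attached to pairs of variables -/

section IsFactorAt

variable {σ : Type*} {K : Type*} [Field K]

/-- `f` is an irreducible factor of `F` attached to the pair `i, j`: its leading form is divisible
by `X i - X j`. -/
def IsFactorAt (F : MvPolynomial σ K) (i j : σ) (f : MvPolynomial σ K) : Prop :=
  Irreducible f ∧ f ∣ F ∧ X i - X j ∣ leadingForm f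

namespace IsFactorAt

variable {F f f' : MvPolynomial σ K} {i j : σ}

theorem symm (h : IsFactorAt F i j f) : IsFactorAt F j i f :=
  ⟨h.1, h.2.1, by rw [← neg_sub, neg_dvd]; exact h.2.2⟩

theorem of_associated (h : IsFactorAt F i j f) (hf : Associated f f') : IsFactorAt F i j f' :=
  ⟨hf.irreducible h.1, hf.dvd_iff_dvd_left.1 h.2.1, h.2.2.trans (leadingForm_dvd hf.dvd)⟩

theorem rename (h : IsFactorAt F i j f) {g : Equiv.Perm σ} (hg : rename g F = F) :
    IsFactorAt F (g i) (g j) (rename g f) := by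
  refine ⟨(MulEquiv.irreducible_iff (renameEquiv K g)).2 h.1, ?_, ?_⟩
  · conv_rhs => rw [← hg]
    exact map_dvd _ h.2.1
  · rw [leadingForm_rename]
    simpa using map_dvd (MvPolynomial.rename g) h.2.2

/-- If `X i - X j` divides the leading form of `F` only once, then just one irreducible factor
of `F` is attached to `i, j`. -/
theorem associated (hF : ¬ (X i - X j) ^ 2 ∣ leadingForm F) (h : IsFactorAt F i j f)
    (h' : IsFactorAt F i j f') : Associated f f' := by
  by_contra hne
  have hrel : IsRelPrime f f' :=
    h.1.isRelPrime_iff_not_dvd.2 fun hd => hne (h.1.associated_of_dvd h'.1 hd)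
  refine hF ?_
  calc (X i - X j) ^ 2 = (X i - X j) * (X i - X j) := pow_two _
    _ ∣ leadingForm f * leadingForm f' := mul_dvd_mul h.2.2 h'.2.2
    _ = leadingForm (f * f') := (leadingForm_mul f f').symm
    _ ∣ leadingForm F := leadingForm_dvd (hrel.mul_dvd h.2.1 h'.2.1)

variable [Fintype σ] [DecidableEq σ]

/-- If one factor is attached to two different pairs, it is attached to all pairs. -/
theorem forall_of_ne (hσ : 5 ≤ Fintype.card σ)
    (hF : ∀ i j, i ≠ j → ¬ (X i - X j) ^ 2 ∣ leadingForm F)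
    (hinv : ∀ g : Equiv.Perm σ, Equiv.Perm.sign g = 1 → MvPolynomial.rename g F = F)
    {k l : σ} (hij : i ≠ j) (hkl : k ≠ l) (hne : s(i, j) ≠ s(k, l))
    (h : IsFactorAt F i j f) (h' : IsFactorAt F k l f) {x y : σ} (hxy : x ≠ y) :
    IsFactorAt F x y f := by
  let G : SimpleGraph σ :=
    { Adj := fun a b => a ≠ b ∧ IsFactorAt F a b f
      symm := ⟨fun a b hab => ⟨hab.1.symm, hab.2.symm⟩⟩
      loopless := ⟨fun a ha => ha.1 rfl⟩ }
  have hG : G = ⊤ := by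
    refine SimpleGraph.eq_top_of_forall_even hσ ?_ (show G.Adj i j from ⟨hij, h⟩)
      (show G.Adj k l from ⟨hkl, h'⟩) hne
    intro g hg a b hab hgab x y hxy
    exact ⟨g.injective.ne hxy.1, (hxy.2.rename (hinv g hg)).of_associated
      ((hab.2.rename (hinv g hg)).associated (hF _ _ hgab.1) hgab.2)⟩
  have : G.Adj x y := by rw [hG]; exact hxy
  exact this.2

end IsFactorAt

end IsFactorAt

/-! ### Irreducibility -/

section Irreducibility

variable {K : Type*} [Field K] {m : ℕ} {s₁ s₂ : MvPolynomial (Fin m) K}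

theorem leadingForm_mul_vandermondePolynomial_add (hm : 5 ≤ m) (h₁ : s₁ ≠ 0)
    (hd₂ : ∀ i, degreeOf i s₂ ≤ 1) :
    leadingForm (s₁ * vandermondePolynomial K m + s₂) =
      leadingForm s₁ * vandermondePolynomial K m := by
  rw [leadingForm_add_of_totalDegree_lt, leadingForm_mul,
    leadingForm_of_isHomogeneous isHomogeneous_vandermondePolynomial]
  have h := totalDegree_le_card_of_degreeOf_le_one hd₂
  rw [Fintype.card_fin] at h
  rw [totalDegree_mul_of_isDomain h₁ vandermondePolynomial_ne_zero,
    isHomogeneous_vandermondePolynomial.totalDegree vandermondePolynomial_ne_zero]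
  have := lt_card_orderedPairs hm
  omega

theorem mul_vandermondePolynomial_add_ne_zero (hm : 5 ≤ m) (h₁ : s₁ ≠ 0)
    (hd₂ : ∀ i, degreeOf i s₂ ≤ 1) : s₁ * vandermondePolynomial K m + s₂ ≠ 0 := fun h0 => by
  have h := leadingForm_mul_vandermondePolynomial_add hm h₁ hd₂
  rw [h0] at h
  exact mul_ne_zero (leadingForm_ne_zero h₁) vandermondePolynomial_ne_zero
    (h.symm.trans (by simp [leadingForm]))

theorem rename_mul_vandermondePolynomial_add (hs₁ : s₁.IsSymmetric) (hs₂ : s₂.IsSymmetric)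
    (g : Equiv.Perm (Fin m)) : rename g (s₁ * vandermondePolynomial K m + s₂) =
      ((Equiv.Perm.sign g : ℤ) : MvPolynomial (Fin m) K) * (s₁ * vandermondePolynomial K m) +
        s₂ := by
  rw [map_add, map_mul, hs₁, hs₂, rename_vandermondePolynomial]
  ring

theorem not_X_sub_X_sq_dvd_leadingForm (h2 : (2 : K) ≠ 0) (hm : 5 ≤ m) (h₁ : s₁ ≠ 0)
    (hs₁ : s₁.IsSymmetric) (hd₁ : ∀ i, degreeOf i s₁ ≤ 1) (hd₂ : ∀ i, degreeOf i s₂ ≤ 1)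
    {i j : Fin m} (hij : i ≠ j) :
    ¬ (X i - X j) ^ 2 ∣ leadingForm (s₁ * vandermondePolynomial K m + s₂) := by
  rw [leadingForm_mul_vandermondePolynomial_add hm h₁ hd₂]
  refine not_X_sub_X_sq_dvd_mul_vandermondePolynomial hij
    (not_X_sub_X_dvd_of_isSymmetric h2 hij (fun g => ?_)
      (fun k => (degreeOf_leadingForm_le k s₁).trans (hd₁ k)) (leadingForm_ne_zero h₁))
  rw [← leadingForm_rename, hs₁ g]

theorem MvPolynomial.eq_C_of_isSymmetric_of_degreeOf_eq_zero {σ : Type*} [DecidableEq σ] {i : σ}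
    {h : MvPolynomial σ K} (hs : h.IsSymmetric) (hd : degreeOf i h = 0) : ∃ c, h = C c := by
  refine ⟨_, (totalDegree_eq_zero_iff_eq_C (p := h)).1 ((totalDegree_eq_zero_iff (p := h)).2 ?_)⟩
  intro d hdm k
  have : degreeOf k h = 0 := by
    have := degreeOf_rename_of_injective (p := h) (Equiv.swap i k).injective i
    rwa [hs, hd, Equiv.swap_apply_left] at this
  exact Nat.le_zero.1 (this ▸ monomial_le_degreeOf k hdm)

/-- A symmetric common divisor of two multi-affine polynomials that are not proportional is
constant: if nonconstant, it would have degree one in each variable, with constant cofactors. -/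
theorem MvPolynomial.eq_C_of_isSymmetric_of_dvd_of_dvd {h : MvPolynomial (Fin m) K}
    (hs : h.IsSymmetric) (hd₁ : ∀ i, degreeOf i s₁ ≤ 1) (hd₂ : ∀ i, degreeOf i s₂ ≤ 1)
    (h₁ : s₁ ≠ 0) (h₂ : s₂ ≠ 0) (hind : ∀ c, s₁ ≠ C c * s₂) (hs₁ : h ∣ s₁) (hs₂ : h ∣ s₂) :
    ∃ c, h = C c := by
  by_contra hc
  have hpos : ∀ i, 1 ≤ degreeOf i h := fun i =>
    Nat.one_le_iff_ne_zero.2 fun hz => hc (eq_C_of_isSymmetric_of_degreeOf_eq_zero hs hz)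
  have key : ∀ s : MvPolynomial (Fin m) K, s ≠ 0 → (∀ i, degreeOf i s ≤ 1) → h ∣ s →
      ∃ c, s = C c * h := by
    rintro s hs0 hd ⟨r, rfl⟩
    have hr : r.totalDegree = 0 := by
      rw [totalDegree_eq_zero_iff]
      intro d hdm i
      have h1 := monomial_le_degreeOf i hdm
      have h2 := hd i
      have h3 := hpos i
      rw [degreeOf_mul_eq (left_ne_zero_of_mul hs0) (right_ne_zero_of_mul hs0)] at h2
      omega
    rw [totalDegree_eq_zero_iff_eq_C] at hr
    exact ⟨_, by rw [mul_comm]; congr 1⟩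
  obtain ⟨c, hc₁⟩ := key s₁ h₁ hd₁ hs₁
  obtain ⟨e, he⟩ := key s₂ h₂ hd₂ hs₂
  have he0 : e ≠ 0 := by
    rintro rfl
    simp [he] at h₂
  refine hind (c / e) ?_
  rw [hc₁, he, ← mul_assoc, ← C_mul, div_mul_cancel₀ _ he0]

/-- The case in which all linear factors of the Vandermonde polynomial occur in the leading form of
a single irreducible factor `f`. The cofactor of `f` is then multi-affine and symmetric and divides
both `s₁` and `s₂`. -/
theorem irreducible_of_forall_isFactorAt (h2 : (2 : K) ≠ 0) (hm : 5 ≤ m)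
    (hs₁ : s₁.IsSymmetric) (hs₂ : s₂.IsSymmetric)
    (hd₁ : ∀ i, degreeOf i s₁ ≤ 1) (hd₂ : ∀ i, degreeOf i s₂ ≤ 1)
    (h₁ : s₁ ≠ 0) (h₂ : s₂ ≠ 0) (hind : ∀ c, s₁ ≠ C c * s₂) {f : MvPolynomial (Fin m) K}
    (hf : ∀ i j, i ≠ j → IsFactorAt (s₁ * vandermondePolynomial K m + s₂) i j f) :
    Irreducible (s₁ * vandermondePolynomial K m + s₂) := by
  set v := vandermondePolynomial K m with hv
  have hcard : 5 ≤ Fintype.card (Fin m) := by simpa using hm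
  let a : Fin m := ⟨0, by omega⟩
  let b : Fin m := ⟨1, by omega⟩
  have hab : a ≠ b := by simp [a, b]
  have hF0 : s₁ * v + s₂ ≠ 0 := mul_vandermondePolynomial_add_ne_zero hm h₁ hd₂
  obtain ⟨h, hh⟩ := (hf a b hab).2.1
  have hf0 : f ≠ 0 := (hf a b hab).1.ne_zero
  have hh0 : h ≠ 0 := right_ne_zero_of_mul (hh ▸ hF0)
  have heven : ∀ g : Equiv.Perm (Fin m), Equiv.Perm.sign g = 1 →
      rename g (s₁ * v + s₂) = s₁ * v + s₂ := fun g hg => by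
    rw [rename_mul_vandermondePolynomial_add hs₁ hs₂, hg]
    simp [hv]
  -- The leading form of `f` is a multiple of `v`, which leaves degree at most one for `h`.
  have hvf : v ∣ leadingForm f := by
    rw [hv, vandermondePolynomial_eq_prod]
    refine Finset.prod_dvd_of_isRelPrime (fun p hp q hq hpq => ?_)
      fun p hp => (hf p.1 p.2 (mem_orderedPairs.1 hp).ne).2.2
    have hp' := mem_orderedPairs.1 hp
    have hq' := mem_orderedPairs.1 hq
    refine (prime_X_sub_X hp'.ne).irreducible.isRelPrime_iff_not_dvd.2 fun hd => ?_
    refine not_X_sub_X_sq_dvd_mul_vandermondePolynomial (R := K) hp'.ne (t := 1)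
      (fun h => (prime_X_sub_X hp'.ne).not_isUnit (isUnit_of_dvd_one h)) ?_
    rw [one_mul, vandermondePolynomial_eq_prod, ← Finset.mul_prod_erase _ _ hp, pow_two]
    exact mul_dvd_mul_left _ (hd.trans (Finset.dvd_prod_of_mem
      (fun p : Fin m × Fin m => (X p.1 - X p.2 : MvPolynomial _ K))
      (Finset.mem_erase.2 ⟨hpq.symm, hq⟩)))
  have hhd : ∀ i, degreeOf i h ≤ 1 := by
    intro i
    obtain ⟨u, hu⟩ := hvf
    have hu0 : u ≠ 0 := right_ne_zero_of_mul (hu ▸ leadingForm_ne_zero hf0)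
    have e1 : degreeOf i v ≤ degreeOf i f := by
      refine le_trans ?_ (degreeOf_leadingForm_le i f)
      rw [hu, degreeOf_mul_eq vandermondePolynomial_ne_zero hu0]
      exact Nat.le_add_right _ _
    have e2 : degreeOf i (s₁ * v + s₂) = degreeOf i f + degreeOf i h := by
      rw [hh, degreeOf_mul_eq hf0 hh0]
    have e3 := degreeOf_add_le i (s₁ * v) s₂
    rw [e2, degreeOf_mul_eq h₁ (vandermondePolynomial_ne_zero : v ≠ 0), ← hv] at e3
    have e4 := hd₁ i
    have e5 := hd₂ i
    omega
  have hassoc : ∀ g : Equiv.Perm (Fin m), Equiv.Perm.sign g = 1 → Associated h (rename g h) := by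
    intro g hg
    have e1 : Associated f (rename g f) := by
      have h1 := hf (g a) (g b) (g.injective.ne hab)
      exact h1.associated
        (not_X_sub_X_sq_dvd_leadingForm h2 hm h₁ hs₁ hd₁ hd₂ (g.injective.ne hab))
        ((hf a b hab).rename (heven g hg))
    have e2 := heven g hg
    rw [hh, map_mul] at e2
    exact Associated.of_mul_left (.of_eq e2.symm) e1 hf0
  have hsym : h.IsSymmetric := isSymmetric_of_forall_sign_eq_one (by omega) hhd
    fun g hg => rename_eq_of_forall_associated hcard hh0 hassoc hg
  -- Apply a transposition to `s₁ * v + s₂ = f * h` and take the sum and the difference.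
  have hneg : -(s₁ * v) + s₂ = rename (Equiv.swap a b) f * h := by
    have := rename_mul_vandermondePolynomial_add hs₁ hs₂ (Equiv.swap a b)
    rw [← hv, hh, map_mul, hsym, Equiv.Perm.sign_swap hab] at this
    rw [this]
    simp
  have h2u : IsUnit (2 : MvPolynomial (Fin m) K) := by
    rw [← map_ofNat C 2]
    exact (IsUnit.mk0 (2 : K) h2).map C
  have hdvd₂ : h ∣ s₂ := by
    refine (h2u.dvd_mul_left).1 ⟨f + rename (Equiv.swap a b) f, ?_⟩
    linear_combination hh + hneg
  have hdvd₁ : h ∣ s₁ := by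
    have hd : h ∣ s₁ * v := by
      refine (h2u.dvd_mul_left).1 ⟨f - rename (Equiv.swap a b) f, ?_⟩
      linear_combination hh - hneg
    refine IsRelPrime.dvd_of_dvd_mul_right ?_ hd
    rw [hv, vandermondePolynomial_eq_prod]
    refine IsRelPrime.prod_right fun p hp => IsRelPrime.symm ?_
    have hp' := (mem_orderedPairs.1 hp).ne
    exact (prime_X_sub_X hp').irreducible.isRelPrime_iff_not_dvd.2 fun hd =>
      not_X_sub_X_dvd_of_isSymmetric h2 hp' hs₂ hd₂ h₂ (hd.trans hdvd₂)
  obtain ⟨c, rfl⟩ := eq_C_of_isSymmetric_of_dvd_of_dvd hsym hd₁ hd₂ h₁ h₂ hind hdvd₁ hdvd₂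
  have hc0 : c ≠ 0 := by
    rintro rfl
    simp at hh0
  rw [hh]
  exact (irreducible_mul_isUnit ((IsUnit.mk0 c hc0).map C)).2 (hf a b hab).1

/-- A factor attached to `i, j` has total degree at least two: otherwise it is
`c * (X i - X j) + d`, and applying the transposition of `i, j` together with a disjoint one
shows `d = 0`. -/
theorem IsFactorAt.two_le_totalDegree (h2 : (2 : K) ≠ 0) (hm : 5 ≤ m)
    (hs₁ : s₁.IsSymmetric) (hs₂ : s₂.IsSymmetric)
    (hd₁ : ∀ i, degreeOf i s₁ ≤ 1) (hd₂ : ∀ i, degreeOf i s₂ ≤ 1)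
    (h₁ : s₁ ≠ 0) (h₂ : s₂ ≠ 0) {i j : Fin m} (hij : i ≠ j) {f : MvPolynomial (Fin m) K}
    (hf : IsFactorAt (s₁ * vandermondePolynomial K m + s₂) i j f) : 2 ≤ f.totalDegree := by
  by_contra hlt
  have hcard : 5 ≤ Fintype.card (Fin m) := by simpa using hm
  obtain ⟨u, hu⟩ := hf.2.2
  have hl0 := leadingForm_ne_zero hf.1.ne_zero
  have hu0 : u ≠ 0 := right_ne_zero_of_mul (hu ▸ hl0)
  have hX : (X i - X j : MvPolynomial (Fin m) K).IsHomogeneous 1 :=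
    (isHomogeneous_X K i).sub (isHomogeneous_X K j)
  have hdeg : f.totalDegree = 1 + u.totalDegree := by
    rw [← (isHomogeneous_leadingForm f).totalDegree hl0, hu,
      totalDegree_mul_of_isDomain (X_sub_X_ne_zero hij) hu0, hX.totalDegree (X_sub_X_ne_zero hij)]
  have hf1 : f.totalDegree = 1 := by omega
  obtain ⟨c, rfl⟩ : ∃ c, u = C c := ⟨_, totalDegree_eq_zero_iff_eq_C.1 (by omega)⟩
  have hfe : f = C (coeff 0 f) + (X i - X j) * C c := by
    conv_lhs => rw [← sum_homogeneousComponent f, hf1]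
    rw [Finset.sum_range_succ, Finset.sum_range_one, homogeneousComponent_zero, ← hu, leadingForm,
      hf1]
  obtain ⟨k, hki, hkj, -, -⟩ := exists_ne_four hcard i j i j
  obtain ⟨l, hli, hlj, hlk, -⟩ := exists_ne_four hcard i j k k
  set g : Equiv.Perm (Fin m) := Equiv.swap i j * Equiv.swap k l with hg
  have hgi : g i = j := by simp [hg, Equiv.swap_apply_of_ne_of_ne hki.symm hli.symm]
  have hgj : g j = i := by simp [hg, Equiv.swap_apply_of_ne_of_ne hkj.symm hlj.symm]
  have hinv : MvPolynomial.rename g (s₁ * vandermondePolynomial K m + s₂) =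
      s₁ * vandermondePolynomial K m + s₂ := by
    rw [rename_mul_vandermondePolynomial_add hs₁ hs₂, hg, Equiv.Perm.sign_mul,
      Equiv.Perm.sign_swap hij, Equiv.Perm.sign_swap hlk.symm]
    simp
  have hgf := hf.rename hinv
  rw [hgi, hgj] at hgf
  have hd : f ∣ MvPolynomial.rename g f :=
    (hf.associated (not_X_sub_X_sq_dvd_leadingForm h2 hm h₁ hs₁ hd₁ hd₂ hij) hgf.symm).dvd
  have hd2 : f ∣ C (2 * coeff 0 f) := by
    have e : MvPolynomial.rename g f + f = C (2 * coeff 0 f) := by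
      have : MvPolynomial.rename g f = C (coeff 0 f) + (X j - X i) * C c := by
        conv_lhs => rw [hfe]
        simp [hgi, hgj]
      rw [this]
      conv_lhs => enter [2]; rw [hfe]
      rw [C_mul, map_ofNat C 2]
      ring
    exact e ▸ dvd_add hd dvd_rfl
  have h0 : coeff 0 f = 0 := by
    by_contra h0
    exact hf.1.not_isUnit (isUnit_of_dvd_unit hd2 ((IsUnit.mk0 _ (mul_ne_zero h2 h0)).map C))
  rw [h0, C_0, zero_add] at hfe
  have hdv : X i - X j ∣ s₁ * vandermondePolynomial K m + s₂ :=
    (Dvd.intro _ hfe.symm).trans hf.2.1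
  exact not_X_sub_X_dvd_of_isSymmetric h2 hij hs₂ hd₂ h₂
    ((dvd_add_right ((X_sub_X_dvd_vandermondePolynomial hij).mul_left s₁)).1 hdv)

/-- Irreducibility of `s₁ * v + s₂` over any field with `2 ≠ 0`, by distinguishing whether two of the
factors attached to pairs of variables are associated. -/
theorem irreducible_mul_vandermondePolynomial_add (h2 : (2 : K) ≠ 0) (hm : 5 ≤ m)
    (hs₁ : s₁.IsSymmetric) (hs₂ : s₂.IsSymmetric)
    (hd₁ : ∀ i, degreeOf i s₁ ≤ 1) (hd₂ : ∀ i, degreeOf i s₂ ≤ 1)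
    (h₁ : s₁ ≠ 0) (h₂ : s₂ ≠ 0) (hind : ∀ c, s₁ ≠ C c * s₂) :
    Irreducible (s₁ * vandermondePolynomial K m + s₂) := by
  set F := s₁ * vandermondePolynomial K m + s₂ with hFdef
  have hcard : 5 ≤ Fintype.card (Fin m) := by simpa using hm
  have hlead : leadingForm F = leadingForm s₁ * vandermondePolynomial K m :=
    leadingForm_mul_vandermondePolynomial_add hm h₁ hd₂
  have hF0 : F ≠ 0 := mul_vandermondePolynomial_add_ne_zero hm h₁ hd₂
  have hsq : ∀ i j, i ≠ j → ¬ (X i - X j) ^ 2 ∣ leadingForm F := fun i j hij =>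
    not_X_sub_X_sq_dvd_leadingForm h2 hm h₁ hs₁ hd₁ hd₂ hij
  have heven : ∀ g : Equiv.Perm (Fin m), Equiv.Perm.sign g = 1 → rename g F = F := fun g hg => by
    rw [hFdef, rename_mul_vandermondePolynomial_add hs₁ hs₂, hg]
    simp
  have hex : ∀ p : Fin m × Fin m, ∃ f, p ∈ orderedPairs m → IsFactorAt F p.1 p.2 f := by
    intro p
    by_cases hp : p ∈ orderedPairs m
    · have hne := (mem_orderedPairs.1 hp).ne
      obtain ⟨f, hf⟩ := exists_irreducible_dvd_leadingForm hF0 (prime_X_sub_X hne)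
        (hlead ▸ (X_sub_X_dvd_vandermondePolynomial hne).mul_left _)
      exact ⟨f, fun _ => hf⟩
    · exact ⟨0, fun h => absurd h hp⟩
  choose f hf using hex
  by_cases hcase : ∃ p ∈ orderedPairs m, ∃ q ∈ orderedPairs m, p ≠ q ∧ Associated (f q) (f p)
  · obtain ⟨p, hp, q, hq, hpq, has⟩ := hcase
    have hp' := mem_orderedPairs.1 hp
    have hq' := mem_orderedPairs.1 hq
    have hne : s(p.1, p.2) ≠ s(q.1, q.2) := by
      intro h
      rcases Sym2.eq_iff.1 h with ⟨e1, e2⟩ | ⟨e1, e2⟩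
      · exact hpq (Prod.ext e1 e2)
      · exact lt_asymm hp' (by rw [e1, e2]; exact hq')
    exact irreducible_of_forall_isFactorAt h2 hm hs₁ hs₂ hd₁ hd₂ h₁ h₂ hind fun i j hij =>
      (hf p hp).forall_of_ne hcard hsq heven hp'.ne hq'.ne hne ((hf q hq).of_associated has) hij
  -- Otherwise the product of the pairwise coprime `f p` divides `F`, and its degree is too large.
  exfalso
  have hdvd : ∏ p ∈ orderedPairs m, f p ∣ F := by
    refine Finset.prod_dvd_of_isRelPrime (fun p hp q hq hpq => ?_) fun p hp => (hf p hp).2.1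
    exact (hf p hp).1.isRelPrime_iff_not_dvd.2 fun hd => hcase
      ⟨p, hp, q, hq, hpq, ((hf p hp).1.associated_of_dvd (hf q hq).1 hd).symm⟩
  have hprod : (∏ p ∈ orderedPairs m, f p).totalDegree =
      ∑ p ∈ orderedPairs m, (f p).totalDegree := by
    clear hdvd hcase
    have : ∀ S ⊆ orderedPairs m, (∏ p ∈ S, f p).totalDegree = ∑ p ∈ S, (f p).totalDegree := by
      intro S
      induction S using Finset.induction_on with
      | empty => simp
      | insert q S hq ih =>
        intro hS
        rw [Finset.insert_subset_iff] at hS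
        rw [Finset.prod_insert hq, Finset.sum_insert hq, totalDegree_mul_of_isDomain
          (hf q hS.1).1.ne_zero (Finset.prod_ne_zero_iff.2 fun p hp => (hf p (hS.2 hp)).1.ne_zero),
          ih hS.2]
    exact this _ subset_rfl
  have hle := totalDegree_le_of_dvd_of_isDomain hdvd hF0
  have hsum : (orderedPairs m).card * 2 ≤ ∑ p ∈ orderedPairs m, (f p).totalDegree := by
    rw [← smul_eq_mul]
    exact Finset.card_nsmul_le_sum _ _ _ fun p hp =>
      (hf p hp).two_le_totalDegree h2 hm hs₁ hs₂ hd₁ hd₂ h₁ h₂ (mem_orderedPairs.1 hp).ne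
  have hFdeg : F.totalDegree ≤ m + (orderedPairs m).card := by
    have e1 := totalDegree_le_card_of_degreeOf_le_one hd₁
    have e2 := totalDegree_le_card_of_degreeOf_le_one hd₂
    rw [Fintype.card_fin] at e1 e2
    have e3 := totalDegree_add (s₁ * vandermondePolynomial K m) s₂
    rw [totalDegree_mul_of_isDomain h₁ vandermondePolynomial_ne_zero,
      isHomogeneous_vandermondePolynomial.totalDegree vandermondePolynomial_ne_zero] at e3
    exact e3.trans (max_le (by omega) (by omega))
  have := lt_card_orderedPairs hm
  omega

/-! ### Linear combinations of elementary symmetric polynomials -/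

theorem isSymmetric_of_mem_elementarySymmetricSpace {R : Type*} [CommRing R]
    {s : MvPolynomial (Fin m) R} (hs : s ∈ elementarySymmetricSpace R m) : s.IsSymmetric := by
  have : elementarySymmetricSpace R m ≤
      Subalgebra.toSubmodule (symmetricSubalgebra (Fin m) R) := by
    rw [elementarySymmetricSpace, Submodule.span_le]
    rintro _ ⟨i, rfl⟩
    exact esymm_isSymmetric (Fin m) R i
  exact this hs

theorem degreeOf_le_one_of_mem_elementarySymmetricSpace {R : Type*} [CommRing R]
    {s : MvPolynomial (Fin m) R} (hs : s ∈ elementarySymmetricSpace R m) (i : Fin m) :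
    degreeOf i s ≤ 1 := by
  have : elementarySymmetricSpace R m ≤ restrictDegree (Fin m) R 1 := by
    rw [elementarySymmetricSpace, Submodule.span_le]
    rintro _ ⟨k, rfl⟩
    simp only [esymm_eq_sum_monomial]
    refine Submodule.sum_mem _ fun t _ => ?_
    rw [mem_restrictDegree]
    intro d hd j
    rw [Finset.mem_singleton.1 (support_monomial_subset hd), Finsupp.finsetSum_apply]
    simp only [Finsupp.single_apply, Finset.sum_ite_eq']
    split_ifs <;> simp
  exact degreeOf_le_iff.2 fun d hd => (mem_restrictDegree _ _ _).1 (this hs) d hd i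

end Irreducibility

theorem mainTheorem3 {K : Type*} [Field K] [Finite K] (hq : Odd (Nat.card K))
    (m : ℕ) (hm : 6 ≤ m) (s₁ s₂ : MvPolynomial (Fin m) K)
    (hs₁ : s₁ ∈ elementarySymmetricSpace K m) (hs₂ : s₂ ∈ elementarySymmetricSpace K m)
    (hind : LinearIndependent K ![s₁, s₂]) :
    IsAbsolutelyIrreducible (s₁ * vandermondePolynomial K m + s₂) := by
  let φ := algebraMap K (AlgebraicClosure K)
  have hφ : Function.Injective φ := φ.injective
  have h2K : (2 : K) ≠ 0 := by
    have := Fintype.ofFinite K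
    rw [Nat.card_eq_fintype_card, Nat.odd_iff] at hq
    refine Ring.two_ne_zero fun h => ?_
    have := FiniteField.even_card_of_char_two h
    omega
  have h2 : (2 : AlgebraicClosure K) ≠ 0 := by
    rw [← map_ofNat φ 2]
    exact (map_ne_zero φ).2 h2K
  have h₁ : s₁ ≠ 0 := hind.ne_zero 0
  have h₂ : s₂ ≠ 0 := hind.ne_zero 1
  have hdeg : ∀ {s : MvPolynomial (Fin m) K}, s ∈ elementarySymmetricSpace K m → ∀ i,
      degreeOf i (map φ s) ≤ 1 := fun hs i => by
    refine degreeOf_le_iff.2 fun d hd => ?_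
    exact (monomial_le_degreeOf i (support_map_subset φ _ hd)).trans
      (degreeOf_le_one_of_mem_elementarySymmetricSpace hs i)
  rw [IsAbsolutelyIrreducible, map_add, map_mul, map_vandermondePolynomial]
  refine irreducible_mul_vandermondePolynomial_add h2 (by omega)
    ((isSymmetric_of_mem_elementarySymmetricSpace hs₁).map φ)
    ((isSymmetric_of_mem_elementarySymmetricSpace hs₂).map φ) (hdeg hs₁) (hdeg hs₂)
    ((map_ne_zero_iff _ (map_injective φ hφ)).2 h₁)
    ((map_ne_zero_iff _ (map_injective φ hφ)).2 h₂) fun c hc => ?_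
  -- A factor of proportionality is a quotient of coefficients, hence lies in `K`.
  obtain ⟨d, hd⟩ := ne_zero_iff.1 h₂
  have hcd : c = φ (coeff d s₁ / coeff d s₂) := by
    have := congrArg (coeff d) hc
    rw [coeff_C_mul, coeff_map, coeff_map] at this
    rw [map_div₀, this, mul_div_cancel_right₀ _ ((map_ne_zero φ).2 hd)]
  rw [hcd, ← map_C, ← map_mul] at hc
  have hs := map_injective φ hφ hc
  rw [LinearIndependent.pair_iff] at hind
  have := (hind (-1) (coeff d s₁ / coeff d s₂) (by
    rw [smul_eq_C_mul (a := coeff d s₁ / coeff d s₂), ← hs]; simp)).1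
  simp at this
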